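/- Let $V$ be a finite set and let $\Gamma$ be an undirected weighted graph on $V$, given by a weight function $w : V \times V \to \mathbb{R}_{\ge 0}$ with $w(u,v) = w(v,u)$ for all $u, v$ (there is an edge between $u$ and $v$ exactly when $w(u,v) > 0$). Let $L$ be the graph Laplacian of $\Gamma$, i.e. the $V \times V$ matrix $L = D - W$, where $W = (w(u,v))_{u,v \in V}$ and $D$ is the diagonal matrix with entries $D(u,u) = \sum_{v \in V} w(u,v)$. For $t > 0$ let $H_t = e^{-tL}$ (matrix exponential) be the heat kernel of $\Gamma$. Suppose that $\Gamma$ is a weighted Abelian Cayley graph: there is an abelian group structure $+$ on $V$ such that $w(g+u, g+v) = w(u,v)$ for all $g, u, v \in V$. Then $\Gamma$ has monotonic diffusion: for all vertices $u, v \in V$ and all real $0 < t \le t'$, $$\frac{H_t(u,v)}{H_t(u,u)} \le \frac{H_{t'}(u,v)}{H_{t'}(u,u)}.$$ -/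

import Mathlib

/-- A finite undirected weighted graph on the vertex set `V`, given by its weight function:
`weight u v` is the (positive) weight of the edge between `u` and `v`, and it is `0` when there is
no such edge. -/
structure WeightedGraph (V : Type*) where
  /-- The weight of the edge between two vertices (`0` if there is none). -/
  weight : V → V → ℝ
  weight_symm : ∀ u v, weight u v = weight v u
  weight_nonneg : ∀ u v, 0 ≤ weight u v

namespace WeightedGraph

/-- The weighted adjacency matrix `W`. -/
def adjMatrix {V : Type*} (Γ : WeightedGraph V) : Matrix V V ℝ :=
  Matrix.of Γ.weight

/-- The weighted degree of a vertex. -/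
def degree {V : Type*} [Fintype V] (Γ : WeightedGraph V) (u : V) : ℝ :=
  ∑ v, Γ.weight u v

/-- The graph Laplacian `L = D - W`, where `D` is the diagonal matrix of weighted degrees
(a loop at a vertex cancels and has no influence on it). -/
def laplacian {V : Type*} [Fintype V] [DecidableEq V] (Γ : WeightedGraph V) : Matrix V V ℝ :=
  Matrix.diagonal Γ.degree - Γ.adjMatrix

/-- The heat kernel `H_t = e^{-tL}`, a matrix exponential. -/
noncomputable def heatKernel {V : Type*} [Fintype V] [DecidableEq V] (Γ : WeightedGraph V)
    (t : ℝ) : Matrix V V ℝ :=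
  NormedSpace.exp (-(t • Γ.laplacian))

/-- Monotonic diffusion: for all vertices `u`, `v`, the ratio `H_t(u,v) / H_t(u,u)` is
nondecreasing in `t > 0`. -/
def MonotonicDiffusion {V : Type*} [Fintype V] [DecidableEq V] (Γ : WeightedGraph V) : Prop :=
  ∀ t t' : ℝ, 0 < t → t ≤ t' → ∀ u v : V,
    Γ.heatKernel t u v / Γ.heatKernel t u u ≤ Γ.heatKernel t' u v / Γ.heatKernel t' u u

/-- A weighted Abelian Cayley graph: there is an abelian group structure on the vertex set under
which the graph is translation-invariant. -/
def IsAbelianCayley {V : Type*} (Γ : WeightedGraph V) : Prop :=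
  ∃ _ : AddCommGroup V, ∀ g u v : V, Γ.weight (g + u) (g + v) = Γ.weight u v

end WeightedGraph

/-!
Let `W` be the adjacency matrix, `w = weight 0` and `h_t(x) = exp (t W) (x, 0)`. On a Cayley graph
the degree is constant, so the heat kernel is `exp (-t d) • exp (t W)` and the ratio
`H_t(u, v) / H_t(u, u)` is `h_t(u - v) / h_t(0)`. As `h_t' = W h_t` and `w` is even, twice the
numerator of the derivative of `h_t(x) / h_t(0)` is
`∑ s, w s * ((h_t(x + s) + h_t(x - s)) * h_t(0) - 2 * h_t(x) * h_t(s))`, so it suffices to prove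
`2 h(x) h(y) ≤ h(0) (h(x + y) + h(x - y))` for all `x`, `y` (`two_mul_exp_circulant_mul_le`).

Now `h(x) h(y)` is the kernel at `(x, y)` of the walk on `G × G` that moves one of the coordinates
at each jump. Fixing the list `l` of steps up to sign, such a walk chooses for each `s` in `l` one
of `(s, 0)`, `(-s, 0)`, `(0, s)`, `(0, -s)`, which are encoded as "`s` lies in both, in neither, in
only the first, in only the second" of two subsets `P`, `Q` of the positions of `l`. With `σ` the
sum over a subset, the end point is `x = σ P + σ Q - σ l`, `y = σ P - σ Q`. So if `r g` denotes
the number of subsets of sum `g`, then the number of walks to `(x, y)` is the sum of `r g * r g'`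
over `g - g' = y`, `g + g' = x + σ l`. Here `2 g = (x + y) + σ l` and `2 g' = (x - y) + σ l`, and
the sums of `r g ^ 2` and of `r g' ^ 2` over the solutions of these equations count the walks to
`(x + y, 0)` and to `(x - y, 0)`. Hence the inequality holds for each `l` by
`2 r(g) r(g') ≤ r(g) ^ 2 + r(g') ^ 2` (`two_mul_pairWalkCount_le`); averaging over `l` and over
the number of jumps gives it for `h`.
-/

open scoped Kronecker

/-! ### Pairs of sub-multisets of a list of steps -/

/-- The number of ways to choose a sublist of `l` (by positions) whose sum is `g`, as a real. -/
def subsetSumCount {G : Type*} [AddCommGroup G] [DecidableEq G] : List G → G → ℝ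
  | [], g => if g = 0 then 1 else 0
  | s :: l, g => subsetSumCount l g + subsetSumCount l (g - s)

/-- The number of pairs `(P, Q)` of sublists of `l` (by positions) with `σ P - σ Q = y` and
`σ P + σ Q = x + σ l`, where `σ` denotes the sum of a list and `(x, y)` is the argument; the
summation variable is `σ Q`.

A position belonging to both, to neither, to `P` only or to `Q` only contributes `(s, 0)`,
`(-s, 0)`, `(0, s)` or `(0, -s)` to `(x, y)`. So this counts the walks from `(0, 0)` to `(x, y)` in
`G × G` which at each time move one of the two coordinates by plus or minus the prescribed step. -/
def pairWalkCount {G : Type*} [AddCommGroup G] [Fintype G] [DecidableEq G] (l : List G) :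
    G × G → ℝ := fun p =>
  ∑ g, if g + g + p.2 = p.1 + l.sum then subsetSumCount l (g + p.2) * subsetSumCount l g else 0

section Walks

variable {G : Type*} [AddCommGroup G] [Fintype G] [DecidableEq G]

theorem pairWalkCount_nil :
    pairWalkCount ([] : List G) = Pi.single (0, 0) 1 := by
  funext ⟨x, y⟩
  rw [pairWalkCount, Finset.sum_eq_single 0]
  · by_cases hx : x = 0 <;> by_cases hy : y = 0 <;>
      simp [subsetSumCount, hx, hy, eq_comm]
  · intro g _ hg
    simp [subsetSumCount, hg]
  · simp

/-- First-step decomposition of the walks on `G × G`. -/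
theorem pairWalkCount_cons (s : G) (l : List G) (x y : G) :
    pairWalkCount (s :: l) (x, y) = pairWalkCount l (x - s, y) + pairWalkCount l (x + s, y) +
      (pairWalkCount l (x, y - s) + pairWalkCount l (x, y + s)) := by
  have h₁ : pairWalkCount l (x - s, y) = ∑ g, if g + g + y = x + (s + l.sum) then
      subsetSumCount l (g + y - s) * subsetSumCount l (g - s) else 0 := by
    rw [pairWalkCount, ← Equiv.sum_comp (Equiv.subRight s)]
    refine Finset.sum_congr rfl fun g _ => ?_
    simp only [Equiv.subRight_apply]
    rw [show g - s + y = g + y - s by abel]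
    exact if_congr (by grind) rfl rfl
  have h₂ : pairWalkCount l (x + s, y) = ∑ g, if g + g + y = x + (s + l.sum) then
      subsetSumCount l (g + y) * subsetSumCount l g else 0 := by
    simp only [pairWalkCount, add_assoc]
  have h₃ : pairWalkCount l (x, y - s) = ∑ g, if g + g + y = x + (s + l.sum) then
      subsetSumCount l (g + y - s) * subsetSumCount l g else 0 := by
    refine Finset.sum_congr rfl fun g _ => ?_
    simp only [← add_sub_assoc]
    exact if_congr (by grind) rfl rfl
  have h₄ : pairWalkCount l (x, y + s) = ∑ g, if g + g + y = x + (s + l.sum) then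
      subsetSumCount l (g + y) * subsetSumCount l (g - s) else 0 := by
    rw [pairWalkCount, ← Equiv.sum_comp (Equiv.subRight s)]
    refine Finset.sum_congr rfl fun g _ => ?_
    simp only [Equiv.subRight_apply]
    rw [show g - s + (y + s) = g + y by abel]
    exact if_congr (by grind) rfl rfl
  have h : pairWalkCount (s :: l) (x, y) = ∑ g, if g + g + y = x + (s + l.sum) then
      (subsetSumCount l (g + y) + subsetSumCount l (g + y - s)) *
        (subsetSumCount l g + subsetSumCount l (g - s)) else 0 :=
    Finset.sum_congr rfl fun g _ => if_congr (by simp) rfl rfl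
  rw [h, h₁, h₂, h₃, h₄]
  simp only [← Finset.sum_add_distrib]
  refine Finset.sum_congr rfl fun g _ => ?_
  by_cases hg : g + g + y = x + (s + l.sum)
  · simp only [if_pos hg]
    ring
  · simp only [if_neg hg, add_zero]

/-- A walk ending at `(x, y)` is a pair `(P, Q)` with `σ P - σ Q = y` and `2 (σ P) = x + y + σ l`,
`2 (σ Q) = x - y + σ l`. Pairs of two choices of `P`, or of two choices of `Q`, with equal sums
are the walks to `(x + y, 0)` and to `(x - y, 0)`, so the claim is `2 a b ≤ a ^ 2 + b ^ 2`. -/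
theorem two_mul_pairWalkCount_le (l : List G) (x y : G) :
    2 * pairWalkCount l (x, y) ≤ pairWalkCount l (x + y, 0) + pairWalkCount l (x - y, 0) := by
  -- In the count for `(x + y, 0)` the summation variable is shifted from `σ Q` to `σ P`.
  have h : pairWalkCount l (x + y, 0) = ∑ g, if g + g + y = x + l.sum then
      subsetSumCount l (g + y) * subsetSumCount l (g + y) else 0 := by
    rw [pairWalkCount, ← Equiv.sum_comp (Equiv.addRight y)]
    refine Finset.sum_congr rfl fun g _ => ?_
    simp only [Equiv.coe_addRight, add_zero]
    exact if_congr (by grind) rfl rfl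
  rw [h]
  simp only [pairWalkCount, Finset.mul_sum, ← Finset.sum_add_distrib, add_zero]
  refine Finset.sum_le_sum fun g _ => ?_
  by_cases hg : g + g + y = x + l.sum
  · rw [if_pos hg, if_pos hg, if_pos (by grind)]
    nlinarith [sq_nonneg (subsetSumCount l (g + y) - subsetSumCount l g)]
  · rw [if_neg hg, if_neg hg, if_neg (by grind)]
    simp

end Walks

/-! ### Kronecker sums and matrix exponentials -/

/-- The Kronecker sum `A ⊗ 1 + 1 ⊗ A`: the adjacency matrix of the Cartesian square of the weighted
graph with adjacency matrix `A`. -/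
noncomputable def kroneckerSum {n : Type*} [DecidableEq n] (A : Matrix n n ℝ) :
    Matrix (n × n) (n × n) ℝ :=
  A ⊗ₖ (1 : Matrix n n ℝ) + (1 : Matrix n n ℝ) ⊗ₖ A

section Exp

-- The choice of norm is immaterial: it induces the entrywise topology used by `NormedSpace.exp`.
attribute [local instance] Matrix.linftyOpNormedRing Matrix.linftyOpNormedAlgebra

theorem exp_kroneckerSum {n : Type*} [Fintype n] [DecidableEq n] (A : Matrix n n ℝ) :
    NormedSpace.exp (kroneckerSum A) = NormedSpace.exp A ⊗ₖ NormedSpace.exp A := by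
  let f : Matrix n n ℝ →+* Matrix (n × n) (n × n) ℝ :=
    { toFun := fun B => B ⊗ₖ (1 : Matrix n n ℝ)
      map_one' := Matrix.one_kronecker_one
      map_mul' := fun B C => by rw [← Matrix.mul_kronecker_mul, one_mul]
      map_zero' := Matrix.zero_kronecker _
      map_add' := fun B C => Matrix.add_kronecker _ _ _ }
  let g : Matrix n n ℝ →+* Matrix (n × n) (n × n) ℝ :=
    { toFun := fun B => (1 : Matrix n n ℝ) ⊗ₖ B
      map_one' := Matrix.one_kronecker_one
      map_mul' := fun B C => by rw [← Matrix.mul_kronecker_mul, one_mul]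
      map_zero' := Matrix.kronecker_zero _
      map_add' := fun B C => Matrix.kronecker_add _ _ _ }
  have hf : Continuous f := by
    refine continuous_matrix fun i j => ?_
    change Continuous fun B : Matrix n n ℝ => B i.1 j.1 * (1 : Matrix n n ℝ) i.2 j.2
    fun_prop
  have hg : Continuous g := by
    refine continuous_matrix fun i j => ?_
    change Continuous fun B : Matrix n n ℝ => (1 : Matrix n n ℝ) i.1 j.1 * B i.2 j.2
    fun_prop
  have hcomm : Commute (f A) (g A) := by
    change _ ⊗ₖ _ * _ ⊗ₖ _ = _ ⊗ₖ _ * _ ⊗ₖ _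
    rw [← Matrix.mul_kronecker_mul, ← Matrix.mul_kronecker_mul, one_mul, mul_one]
  have hfA : NormedSpace.exp (f A) = f (NormedSpace.exp A) := (NormedSpace.map_exp f hf A).symm
  have hgA : NormedSpace.exp (g A) = g (NormedSpace.exp A) := (NormedSpace.map_exp g hg A).symm
  change NormedSpace.exp (f A + g A) = _
  rw [Matrix.exp_add_of_commute _ _ hcomm, hfA, hgA]
  change _ ⊗ₖ _ * _ ⊗ₖ _ = _
  rw [← Matrix.mul_kronecker_mul, one_mul, mul_one]

theorem hasSum_exp_mulVec {n : Type*} [Fintype n] [DecidableEq n] (A : Matrix n n ℝ) (t : ℝ)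
    (F : n → ℝ) (p : n) :
    HasSum (fun k : ℕ => (k.factorial : ℝ)⁻¹ * t ^ k * (A ^ k).mulVec F p)
      ((NormedSpace.exp (t • A)).mulVec F p) := by
  have h := NormedSpace.exp_series_hasSum_exp' (𝕂 := ℝ) (t • A)
  let φ : Matrix n n ℝ →+ ℝ :=
    { toFun := fun B => B.mulVec F p
      map_zero' := by simp
      map_add' := fun B C => by simp [Matrix.add_mulVec] }
  have hφ : Continuous φ := by
    change Continuous fun B : Matrix n n ℝ => ∑ j, B p j * F j
    fun_prop
  refine (h.map φ hφ).congr_fun fun k => ?_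
  simp [φ, smul_pow, Matrix.smul_mulVec, mul_assoc]

theorem exp_submatrix_equiv {n : Type*} [Fintype n] [DecidableEq n] (A : Matrix n n ℝ)
    (e : n ≃ n) : NormedSpace.exp (A.submatrix e e) = (NormedSpace.exp A).submatrix e e := by
  refine (NormedSpace.map_exp (Matrix.reindexAlgEquiv ℝ ℝ e.symm) ?_ A).symm
  exact continuous_id.matrix_submatrix _ _

theorem hasDerivAt_exp_smul_apply {n : Type*} [Fintype n] [DecidableEq n] (A : Matrix n n ℝ)
    (t : ℝ) (i j : n) :
    HasDerivAt (fun u : ℝ => NormedSpace.exp (u • A) i j)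
      ((A * NormedSpace.exp (t • A)) i j) t := by
  have h := hasDerivAt_exp_smul_const' (𝕂 := ℝ) A t
  exact hasDerivAt_pi.1 (hasDerivAt_pi.1 h i) j

/-- The exponential of a matrix with nonnegative entries has positive diagonal. -/
theorem exp_smul_diag_pos {n : Type*} [Fintype n] [DecidableEq n] {A : Matrix n n ℝ}
    (hA : ∀ i j, 0 ≤ A i j) {t : ℝ} (ht : 0 ≤ t) (i : n) :
    0 < NormedSpace.exp (t • A) i i := by
  have hpow : ∀ (k : ℕ) (i j : n), 0 ≤ (A ^ k) i j := by
    intro k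
    induction k with
    | zero =>
      intro i j
      rw [pow_zero, Matrix.one_apply]
      split_ifs <;> norm_num
    | succ k ih =>
      intro i j
      rw [pow_succ, Matrix.mul_apply]
      exact Finset.sum_nonneg fun z _ => mul_nonneg (ih i z) (hA z j)
  have h := hasSum_exp_mulVec A t (Pi.single i 1) i
  simp only [Matrix.mulVec_single_one, Matrix.col_apply] at h
  have h₀ := le_hasSum h 0 fun k _ =>
    mul_nonneg (mul_nonneg (by positivity) (pow_nonneg ht k)) (hpow k i i)
  simp only [Nat.factorial_zero, Nat.cast_one, inv_one, pow_zero, Matrix.one_apply_eq,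
    mul_one] at h₀
  linarith

theorem exp_algebraMap_add {n : Type*} [Fintype n] [DecidableEq n] (A : Matrix n n ℝ) (c : ℝ) :
    NormedSpace.exp (algebraMap ℝ (Matrix n n ℝ) c + A) = Real.exp c • NormedSpace.exp A := by
  have h : NormedSpace.exp (algebraMap ℝ (Matrix n n ℝ) c) =
      algebraMap ℝ (Matrix n n ℝ) (NormedSpace.exp c) := (NormedSpace.algebraMap_exp_comm c).symm
  rw [Matrix.exp_add_of_commute _ _ (Algebra.commutes c A), h, ← Real.exp_eq_exp_ℝ,
    ← Algebra.smul_def]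

end Exp

/-! ### The inequality for the heat kernel of an abelian group -/

theorem sum_mul_sub_eq_sum_mul_add {G : Type*} [AddCommGroup G] [Fintype G] {w : G → ℝ}
    (hw : ∀ s, w (-s) = w s) (f : G → ℝ) (x : G) :
    ∑ s, w s * f (x - s) = ∑ s, w s * f (x + s) := by
  rw [← Equiv.sum_comp (Equiv.neg G)]
  simp [hw]

section Circulant

open Matrix

variable {G : Type*} [AddCommGroup G] [Fintype G] [DecidableEq G] {w : G → ℝ}

theorem kroneckerSum_circulant_mulVec (w : G → ℝ) (F : G × G → ℝ) (x y : G) :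
    (kroneckerSum (circulant w)).mulVec F (x, y) =
      ∑ s, w s * (F (x - s, y) + F (x, y - s)) := by
  have hx : ∑ s, w s * F (x - s, y) = ∑ z, w (x - z) * F (z, y) := by
    rw [← Equiv.sum_comp (Equiv.subLeft x)]
    simp
  have hy : ∑ s, w s * F (x, y - s) = ∑ z, w (y - z) * F (x, z) := by
    rw [← Equiv.sum_comp (Equiv.subLeft y)]
    simp
  simp only [mul_add, Finset.sum_add_distrib, hx, hy]
  simp [kroneckerSum, Matrix.mulVec, dotProduct, Fintype.sum_prod_type, add_mul,
    Finset.sum_add_distrib, Matrix.one_apply]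

/-- Since `w` is even, each step of the walk may be followed by an independent random sign. -/
theorem kroneckerSum_circulant_mulVec_pairWalkCount (hw : ∀ s, w (-s) = w s) (l : List G) :
    (kroneckerSum (circulant w)).mulVec (pairWalkCount l) =
      ∑ s, (w s / 2) • pairWalkCount (s :: l) := by
  funext ⟨x, y⟩
  rw [kroneckerSum_circulant_mulVec]
  simp only [Finset.sum_apply, Pi.smul_apply, smul_eq_mul, pairWalkCount_cons]
  have hx := sum_mul_sub_eq_sum_mul_add hw (fun z => pairWalkCount l (z, y)) x
  have hy := sum_mul_sub_eq_sum_mul_add hw (fun z => pairWalkCount l (x, z)) y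
  simp only [div_mul_eq_mul_div, ← Finset.sum_div, mul_add, Finset.sum_add_distrib, ← hx, ← hy]
  ring

/-- The inequality `two_mul_pairWalkCount_le`, summed over `k` further steps with weights
`w`. -/
theorem two_mul_kroneckerSum_pow_mulVec_le (hw : ∀ s, w (-s) = w s) (hw₀ : ∀ s, 0 ≤ w s) (k : ℕ)
    (l : List G) (x y : G) :
    2 * (kroneckerSum (circulant w) ^ k).mulVec (pairWalkCount l) (x, y) ≤
      (kroneckerSum (circulant w) ^ k).mulVec (pairWalkCount l) (x + y, 0) +
        (kroneckerSum (circulant w) ^ k).mulVec (pairWalkCount l) (x - y, 0) := by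
  induction k generalizing l with
  | zero => simpa using two_mul_pairWalkCount_le l x y
  | succ k ih =>
    simp only [pow_succ, ← Matrix.mulVec_mulVec, kroneckerSum_circulant_mulVec_pairWalkCount hw,
      Matrix.mulVec_sum, Matrix.mulVec_smul, Finset.sum_apply, Pi.smul_apply, smul_eq_mul,
      Finset.mul_sum, ← Finset.sum_add_distrib]
    refine Finset.sum_le_sum fun s _ => ?_
    have := mul_le_mul_of_nonneg_left (ih (s :: l)) (div_nonneg (hw₀ s) zero_le_two)
    linarith

/-- The inequality `2 h(x) h(y) ≤ h(0) (h(x + y) + h(x - y))` for `h = exp (t W) (·, 0)`, which is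
the heat kernel of the weight `w` up to a positive factor. It follows term by term from
`two_mul_kroneckerSum_pow_mulVec_le`, because `h(x) h(y)` is the entry at `((x, y), (0, 0))` of the
exponential of the Kronecker sum. -/
theorem two_mul_exp_circulant_mul_le (hw : ∀ s, w (-s) = w s) (hw₀ : ∀ s, 0 ≤ w s) {t : ℝ}
    (ht : 0 ≤ t) (x y : G) :
    2 * (NormedSpace.exp (t • circulant w) x 0 * NormedSpace.exp (t • circulant w) y 0) ≤
      (NormedSpace.exp (t • circulant w) (x + y) 0 +
        NormedSpace.exp (t • circulant w) (x - y) 0) * NormedSpace.exp (t • circulant w) 0 0 := by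
  have hprod : ∀ a b : G,
      (NormedSpace.exp (t • kroneckerSum (circulant w))).mulVec (pairWalkCount []) (a, b) =
        NormedSpace.exp (t • circulant w) a 0 * NormedSpace.exp (t • circulant w) b 0 := by
    intro a b
    have : t • kroneckerSum (circulant w) = kroneckerSum (t • circulant w) := by
      simp [kroneckerSum, Matrix.smul_kronecker, Matrix.kronecker_smul]
    rw [this, exp_kroneckerSum, pairWalkCount_nil, Matrix.mulVec_single_one, Matrix.col_apply,
      Matrix.kronecker_apply]
  have hs := fun p => hasSum_exp_mulVec (kroneckerSum (circulant w)) t (pairWalkCount []) p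
  rw [add_mul, ← hprod, ← hprod, ← hprod]
  refine hasSum_le (fun k => ?_) ((hs (x, y)).mul_left 2) ((hs (x + y, 0)).add (hs (x - y, 0)))
  have := mul_le_mul_of_nonneg_left (two_mul_kroneckerSum_pow_mulVec_le hw hw₀ k [] x y)
    (show 0 ≤ (k.factorial : ℝ)⁻¹ * t ^ k by positivity)
  linarith

/-! ### Monotonicity in time -/

theorem exp_circulant_apply (w : G → ℝ) (t : ℝ) (u v : G) :
    NormedSpace.exp (t • circulant w) u v = NormedSpace.exp (t • circulant w) (u - v) 0 := by
  have h := exp_submatrix_equiv (t • circulant w) (Equiv.addRight v)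
  have h' : (t • circulant w).submatrix (Equiv.addRight v) (Equiv.addRight v) =
      t • circulant w := by
    ext i j
    simp
  rw [h'] at h
  simpa using (congrFun (congrFun h (u - v)) 0).symm

theorem monotoneOn_exp_circulant_div (hw : ∀ s, w (-s) = w s) (hw₀ : ∀ s, 0 ≤ w s) (x : G) :
    MonotoneOn (fun t : ℝ => NormedSpace.exp (t • circulant w) x 0 /
      NormedSpace.exp (t • circulant w) 0 0) (Set.Ici 0) := by
  have hpos : ∀ t : ℝ, 0 ≤ t → 0 < NormedSpace.exp (t • circulant w) 0 0 := fun t ht =>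
    exp_smul_diag_pos (fun i j => hw₀ (i - j)) ht 0
  have hder := fun (t : ℝ) (ht : 0 ≤ t) =>
    (hasDerivAt_exp_smul_apply (circulant w) t x 0).div
      (hasDerivAt_exp_smul_apply (circulant w) t 0 0) (hpos t ht).ne'
  refine monotoneOn_of_deriv_nonneg (convex_Ici 0)
    (fun t ht => (hder t ht).continuousAt.continuousWithinAt) ?_ ?_
  · intro t ht
    exact (hder t (interior_subset ht)).differentiableAt.differentiableWithinAt
  · intro t ht
    have ht₀ : 0 ≤ t := interior_subset ht
    have hd := (hder t ht₀).deriv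
    refine le_of_le_of_eq (div_nonneg ?_ (sq_nonneg _)) hd.symm
    have hmul : ∀ z, (circulant w * NormedSpace.exp (t • circulant w)) z 0 =
        ∑ s, w s * NormedSpace.exp (t • circulant w) (z - s) 0 := by
      intro z
      rw [Matrix.mul_apply, ← Equiv.sum_comp (Equiv.subLeft z)]
      simp
    have hx := sum_mul_sub_eq_sum_mul_add hw
      (fun z => NormedSpace.exp (t • circulant w) z 0) x
    have h0 := sum_mul_sub_eq_sum_mul_add hw
      (fun z => NormedSpace.exp (t • circulant w) z 0) 0
    simp only [zero_add] at h0
    -- The numerator of the derivative is half of this sum, by evenness of `w`.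
    have key : 0 ≤ ∑ s, w s * ((NormedSpace.exp (t • circulant w) (x + s) 0 +
        NormedSpace.exp (t • circulant w) (x - s) 0) * NormedSpace.exp (t • circulant w) 0 0 -
        2 * (NormedSpace.exp (t • circulant w) x 0 * NormedSpace.exp (t • circulant w) s 0)) :=
      Finset.sum_nonneg fun s _ => mul_nonneg (hw₀ s)
        (sub_nonneg.2 (two_mul_exp_circulant_mul_le hw hw₀ ht₀ x s))
    have hexp : ∑ s, w s * ((NormedSpace.exp (t • circulant w) (x + s) 0 +
        NormedSpace.exp (t • circulant w) (x - s) 0) * NormedSpace.exp (t • circulant w) 0 0 -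
        2 * (NormedSpace.exp (t • circulant w) x 0 * NormedSpace.exp (t • circulant w) s 0)) =
        (∑ s, w s * NormedSpace.exp (t • circulant w) (x + s) 0 +
          ∑ s, w s * NormedSpace.exp (t • circulant w) (x - s) 0) *
            NormedSpace.exp (t • circulant w) 0 0 -
          2 * NormedSpace.exp (t • circulant w) x 0 *
            ∑ s, w s * NormedSpace.exp (t • circulant w) s 0 := by
      rw [← Finset.sum_add_distrib, Finset.sum_mul, Finset.mul_sum, ← Finset.sum_sub_distrib]
      exact Finset.sum_congr rfl fun s _ => by ring
    rw [hexp, ← hx] at key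
    rw [hmul, hmul, h0]
    linarith

end Circulant

/-- On an abelian Cayley graph the degree is constant and the heat kernel is a positive multiple of
the exponential of a circulant adjacency matrix. -/
theorem WeightedGraph.heatKernel_eq_smul_exp_circulant {V : Type*} [Fintype V] [DecidableEq V]
    [AddCommGroup V] (Γ : WeightedGraph V)
    (hΓ : ∀ g u v : V, Γ.weight (g + u) (g + v) = Γ.weight u v) (t : ℝ) :
    Γ.heatKernel t = Real.exp (-(t * Γ.degree 0)) •
      NormedSpace.exp (t • Matrix.circulant (Γ.weight 0)) := by
  have hadj : Γ.adjMatrix = Matrix.circulant (Γ.weight 0) := by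
    ext u v
    rw [Matrix.circulant_apply, WeightedGraph.adjMatrix, Matrix.of_apply, Γ.weight_symm u v,
      ← hΓ v 0 (u - v), add_zero, add_sub_cancel]
  have hdeg : Γ.degree = fun _ => Γ.degree 0 := by
    funext u
    rw [WeightedGraph.degree, ← Equiv.sum_comp (Equiv.addLeft u)]
    refine Finset.sum_congr rfl fun v _ => ?_
    simpa using hΓ u 0 v
  have hlap : -(t • Γ.laplacian) = algebraMap ℝ (Matrix V V ℝ) (-(t * Γ.degree 0)) +
      t • Matrix.circulant (Γ.weight 0) := by
    rw [WeightedGraph.laplacian, hadj, hdeg, smul_sub, neg_sub, Matrix.algebraMap_eq_diagonal,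
      ← Matrix.diagonal_smul, sub_eq_neg_add, Matrix.diagonal_neg]
    rfl
  rw [WeightedGraph.heatKernel, hlap, exp_algebraMap_add]

theorem mainTheorem1 {V : Type*} [Fintype V] [DecidableEq V] (Γ : WeightedGraph V)
    (hΓ : Γ.IsAbelianCayley) : Γ.MonotonicDiffusion := by
  obtain ⟨inst, hΓ⟩ := hΓ
  intro t t' ht htt' u v
  have hw : ∀ s, Γ.weight 0 (-s) = Γ.weight 0 s := by
    intro s
    rw [← hΓ s 0 (-s), add_zero, add_neg_cancel, Γ.weight_symm]
  simp only [Γ.heatKernel_eq_smul_exp_circulant hΓ, Matrix.smul_apply, smul_eq_mul,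
    mul_div_mul_left _ _ (Real.exp_ne_zero _)]
  rw [exp_circulant_apply _ t u v, exp_circulant_apply _ t u u, exp_circulant_apply _ t' u v,
    exp_circulant_apply _ t' u u, sub_self]
  exact monotoneOn_exp_circulant_div hw (Γ.weight_nonneg 0) (u - v) ht.le (ht.le.trans htt') htt'
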